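/- Let $l\ge 2$ and let $G/K$ be one of the flag manifolds $SO(2l+1)/U(l)$ or $Sp(l)/(U(1)\times Sp(l-1))$. Let $\mathfrak g\supset\mathfrak k$ be the Lie algebras of $G\supset K$, with $\mathfrak g$ realized as the real skew-symmetric $(2l+1)\times(2l+1)$ matrices, respectively as the skew-Hermitian quaternionic $l\times l$ matrices, and $\mathfrak k$ embedded in the standard way (through $\mathbb R^{2l+1}=\mathbb C^l\oplus\mathbb R$, respectively block-diagonally). Let $\mathfrak h\subset\mathfrak k$ be the standard Cartan subalgebra of $\mathfrak g$, consisting of the matrices $H_\theta=\operatorname{diag}(\sqrt{-1}\,\theta_1,\dots,\sqrt{-1}\,\theta_l)$ with $\theta_j\in\mathbb R$, and let $e_j\in(\mathfrak h^{\mathbb C})^*$ be given by $e_j(H_\theta)=\sqrt{-1}\,\theta_j$. Let $R\subset(\mathfrak h^{\mathbb C})^*$ be the root system of $\mathfrak g^{\mathbb C}$ with root spaces $\mathfrak g^\alpha$. As simple roots take $e_1-e_2,\dots,e_{l-1}-e_l$ together with $e_l$ (for $SO(2l+1)$), respectively $2e_l$ (for $Sp(l)$), and let $\alpha_0$ be the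 simple root defining $G/K$, namely $\alpha_0=e_l$ for $SO(2l+1)/U(l)$ and $\alpha_0=e_1-e_2$ for $Sp(l)/(U(1)\times Sp(l-1))$. For a positive root $\alpha$ let $c_0(\alpha)$ be the coefficient of $\alpha_0$ in the expression of $\alpha$ through the simple roots, let $\mathfrak m^\alpha=\mathfrak g\cap(\mathfrak g^\alpha\oplus\mathfrak g^{-\alpha})$, and for $m=1,2$ set $$\mathfrak q^m=\sum_{\alpha\in R^+,\ c_0(\alpha)=m}\mathfrak m^\alpha .$$ Then: (i) $[\mathfrak q^1,\mathfrak q^2]\neq\{0\}$. (ii) For every non-zero vector $\xi$ in the center of $\mathfrak k$ and every non-zero vector $X_2\in\mathfrak q^2$, the bracket $[\xi,X_2]$ is a non-zero vector of $\mathfrak q^2$. -/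

import Mathlib

open scoped TensorProduct Quaternion

attribute [local instance 100] LieRing.ofAssociativeRing

namespace FlagManifold

noncomputable section

/-! ### Root data of a real Lie algebra with respect to an abelian subalgebra -/

section Roots

variable {𝔤 : Type*} [LieRing 𝔤] [LieAlgebra ℝ 𝔤]

/-- The complexification `𝔥^ℂ` of a real subspace `𝔥 ⊆ 𝔤`, inside `𝔤^ℂ = ℂ ⊗ 𝔤`. -/
abbrev complexify (𝔥 : Submodule ℝ 𝔤) : Submodule ℂ (ℂ ⊗[ℝ] 𝔤) := 𝔥.baseChange ℂ

/-- The space `𝔤^α = {X ∈ 𝔤^ℂ : [H, X] = α(H) X for all H ∈ 𝔥^ℂ}`, for `α ∈ (𝔥^ℂ)^*`. -/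
def rootSpace (𝔥 : Submodule ℝ 𝔤) (α : Module.Dual ℂ (complexify 𝔥)) :
    Submodule ℂ (ℂ ⊗[ℝ] 𝔤) :=
  ⨅ H : complexify 𝔥, Module.End.eigenspace (LieAlgebra.ad ℂ (ℂ ⊗[ℝ] 𝔤) H) (α H)

/-- The root system `R ⊆ (𝔥^ℂ)^*` of `𝔤^ℂ` with respect to `𝔥^ℂ`. -/
def roots (𝔥 : Submodule ℝ 𝔤) : Set (Module.Dual ℂ (complexify 𝔥)) :=
  {α | α ≠ 0 ∧ rootSpace 𝔥 α ≠ ⊥}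

/-- The real space `𝔪^α = 𝔤 ∩ (𝔤^α ⊕ 𝔤^{-α})`. If `𝔤` is a compact form with Cartan subalgebra `𝔥`
and `E_α ∈ 𝔤^α`, `E_{-α} ∈ 𝔤^{-α}` belong to a Weyl basis adapted to `𝔤`, then this is the real span
of `A_α = E_α - E_{-α}` and `B_α = √-1 (E_α + E_{-α})`. -/
def realRootSpace (𝔥 : Submodule ℝ 𝔤) (α : Module.Dual ℂ (complexify 𝔥)) : Submodule ℝ 𝔤 :=
  ((rootSpace 𝔥 α ⊔ rootSpace 𝔥 (-α)).restrictScalars ℝ).comap (TensorProduct.mk ℝ ℂ 𝔤 1)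

/-- Given simple roots `Π = {α_i}` and a distinguished index `p`, the set of the positive roots
whose coefficient at the simple root `α_p` is `m`. -/
def rootsOfDegree (𝔥 : Submodule ℝ 𝔤) {ι : Type*} [Fintype ι]
    (simple : ι → Module.Dual ℂ (complexify 𝔥)) (p : ι) (m : ℕ) :
    Set (Module.Dual ℂ (complexify 𝔥)) :=
  {α | α ∈ roots 𝔥 ∧ ∃ c : ι → ℕ, α = ∑ i, c i • simple i ∧ c p = m}

/-- The space `𝔮^m = ∑ 𝔪^α`, the sum over the positive roots `α` whose coefficient at the
distinguished simple root is `m`. -/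
def isotropySummand (𝔥 : Submodule ℝ 𝔤) {ι : Type*} [Fintype ι]
    (simple : ι → Module.Dual ℂ (complexify 𝔥)) (p : ι) (m : ℕ) : Submodule ℝ 𝔤 :=
  ⨆ α ∈ rootsOfDegree 𝔥 simple p m, realRootSpace 𝔥 α

/-- `[𝔞, 𝔟]`, the linear span of all brackets `[X, Y]` with `X ∈ 𝔞` and `Y ∈ 𝔟`. -/
def bracketSpan (𝔞 𝔟 : Submodule ℝ 𝔤) : Submodule ℝ 𝔤 :=
  Submodule.span ℝ {Z | ∃ X ∈ 𝔞, ∃ Y ∈ 𝔟, ⁅X, Y⁆ = Z}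

/-- The element of `(𝔥^ℂ)^*` obtained from a real-linear `f : 𝔤 → ℂ` by restricting it to `𝔥` and
extending complex-linearly. -/
def toDual (𝔥 : Submodule ℝ 𝔤) (f : 𝔤 →ₗ[ℝ] ℂ) : Module.Dual ℂ (complexify 𝔥) :=
  (f.liftBaseChange ℂ).domRestrict (complexify 𝔥)

end Roots

/-! ### The flag manifold `SO(2l+1)/U(l)` -/

section OddOrthogonal

variable (l : ℕ)

/-- Indices of the coordinates of `ℝ^{2l+1} = ℝ^l ⊕ ℝ^l ⊕ ℝ`. The first two summands together are
`ℂ^l`, a vector `x + √-1 y` being `(x, y)`. -/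
abbrev SOIndex : Type := (Fin l ⊕ Fin l) ⊕ Unit

/-- The Lie algebra `so(2l+1)` of `SO(2l+1)`: the real skew-symmetric matrices. -/
abbrev so : LieSubalgebra ℝ (Matrix (SOIndex l) (SOIndex l) ℝ) :=
  LieAlgebra.Orthogonal.so (SOIndex l) ℝ

variable {l} in
/-- The real matrix of the map `Z ⊕ 0` of `ℂ^l ⊕ ℝ = ℝ^{2l+1}`. -/
def realify (Z : Matrix (Fin l) (Fin l) ℂ) : Matrix (SOIndex l) (SOIndex l) ℝ :=
  Matrix.fromBlocks
    (Matrix.fromBlocks (Z.map Complex.re) (-(Z.map Complex.im)) (Z.map Complex.im)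
      (Z.map Complex.re)) 0 0 0

variable {l} in
theorem realify_add (Z W : Matrix (Fin l) (Fin l) ℂ) :
    realify (Z + W) = realify Z + realify W := by
  ext ((i | i) | i) ((j | j) | j) <;> simp [realify] <;> ring

variable {l} in
theorem realify_smul (r : ℝ) (Z : Matrix (Fin l) (Fin l) ℂ) :
    realify (r • Z) = r • realify Z := by
  ext ((i | i) | i) ((j | j) | j) <;> simp [realify]

variable {l} in
theorem realify_mul (Z W : Matrix (Fin l) (Fin l) ℂ) :
    realify (Z * W) = realify Z * realify W := by
  ext ((i | i) | i) ((j | j) | j) <;>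
    simp [realify, Matrix.mul_apply, Finset.sum_add_distrib, Finset.sum_sub_distrib] <;> ring

variable {l} in
theorem realify_sub (Z W : Matrix (Fin l) (Fin l) ℂ) :
    realify (Z - W) = realify Z - realify W := by
  ext ((i | i) | i) ((j | j) | j) <;> simp [realify] <;> ring

/-- The Lie algebra of `U(l) ⊆ SO(2l+1)`: the skew-Hermitian matrices acting on
`ℂ^l ⊕ ℝ = ℝ^{2l+1}` through the first summand. -/
def soIsotropy : LieSubalgebra ℝ (so l) where
  carrier := {X | ∃ Z : Matrix (Fin l) (Fin l) ℂ, Z.conjTranspose = -Z ∧ X.1 = realify Z}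
  add_mem' := by
    rintro X Y ⟨Z, hZ, hX⟩ ⟨W, hW, hY⟩
    refine ⟨Z + W, ?_, ?_⟩
    · rw [Matrix.conjTranspose_add, hZ, hW, neg_add]
    · rw [realify_add, ← hX, ← hY]; rfl
  zero_mem' := by
    refine ⟨0, by simp, ?_⟩
    simpa using (realify_smul (0 : ℝ) (0 : Matrix (Fin l) (Fin l) ℂ)).symm
  smul_mem' := by
    rintro r X ⟨Z, hZ, hX⟩
    refine ⟨r • Z, ?_, ?_⟩
    · rw [Matrix.conjTranspose_smul, hZ]; simp
    · rw [realify_smul, ← hX]; rfl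
  lie_mem' := by
    rintro X Y ⟨Z, hZ, hX⟩ ⟨W, hW, hY⟩
    refine ⟨Z * W - W * Z, ?_, ?_⟩
    · simp [hZ, hW]
    · rw [realify_sub, realify_mul, realify_mul, ← hX, ← hY]; rfl

/-- The standard Cartan subalgebra of `so(2l+1)`: the matrices
`diag(√-1 θ_1, …, √-1 θ_l) ∈ u(l)` with `θ_j` real. -/
def soCartan : Submodule ℝ (so l) where
  carrier := {X | ∃ θ : Fin l → ℝ,
    X.1 = realify (Matrix.diagonal fun j => Complex.I * (θ j : ℂ))}
  add_mem' := by
    rintro X Y ⟨θ, hX⟩ ⟨η, hY⟩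
    refine ⟨θ + η, ?_⟩
    have h : (X + Y).1 = X.1 + Y.1 := rfl
    rw [h, hX, hY, ← realify_add, Matrix.diagonal_add]
    simp [mul_add]
  zero_mem' := by
    refine ⟨0, ?_⟩
    ext ((i | i) | i) ((j | j) | j) <;> simp [realify]
  smul_mem' := by
    rintro r X ⟨θ, hX⟩
    refine ⟨r • θ, ?_⟩
    have h : (r • X).1 = r • X.1 := rfl
    rw [h, hX, ← realify_smul, ← Matrix.diagonal_smul]
    congr 2
    ext j
    simp
    ring

/-- The functional `e_j` with `e_j (diag(√-1 θ_1, …, √-1 θ_l)) = √-1 θ_j`; the roots of `so(2l+1)`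
are `±e_i` and `±e_i ± e_j` with `i ≠ j`. -/
def soCoord (j : Fin l) : Module.Dual ℂ (complexify (soCartan l)) :=
  toDual (soCartan l)
    { toFun := fun X => Complex.I * (X.1 (Sum.inl (Sum.inr j)) (Sum.inl (Sum.inl j)) : ℂ)
      map_add' := by intro X Y; simp [mul_add]
      map_smul' := by intro r X; simp; ring }

/-- The simple roots `e_1 - e_2, …, e_{l-1} - e_l, e_l` of `so(2l+1)`. -/
def soSimple (i : Fin l) : Module.Dual ℂ (complexify (soCartan l)) :=
  if h : (i : ℕ) + 1 < l then soCoord l i - soCoord l ⟨(i : ℕ) + 1, h⟩ else soCoord l i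

/-- The submodule `𝔮^m` (`m = 1, 2`) for `SO(2l+1)/U(l)`; the distinguished simple root is the
last one, `e_l`. -/
def soSummand (hl : 2 ≤ l) (m : ℕ) : Submodule ℝ (so l) :=
  isotropySummand (soCartan l) (soSimple l) ⟨l - 1, by omega⟩ m

end OddOrthogonal

/-! ### The flag manifold `Sp(l)/(U(1) × Sp(l-1))` -/

section Symplectic

variable (l : ℕ)

/-- The Lie algebra `sp(l)` of the compact group `Sp(l)`: the skew-Hermitian quaternionic
matrices. -/
def sp : LieSubalgebra ℝ (Matrix (Fin l) (Fin l) ℍ[ℝ]) where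
  carrier := {X | X.conjTranspose = -X}
  add_mem' := by
    intro X Y hX hY
    change Matrix.conjTranspose _ = -_ at hX hY ⊢
    rw [Matrix.conjTranspose_add, hX, hY, neg_add]
  zero_mem' := by simp
  smul_mem' := by
    intro r X hX
    change Matrix.conjTranspose _ = -_ at hX ⊢
    ext i j : 1
    have h := congrFun (congrFun hX i) j
    simp only [Matrix.conjTranspose_apply, Matrix.neg_apply, Matrix.smul_apply] at *
    rw [Quaternion.star_smul, h, smul_neg]
  lie_mem' := by
    intro X Y hX hY
    change Matrix.conjTranspose _ = -_ at hX hY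
    change (X * Y - Y * X).conjTranspose = -(X * Y - Y * X)
    simp [Matrix.conjTranspose_mul, hX, hY]

/-- The Lie algebra of `U(1) × Sp(l-1) ⊆ Sp(l)`: the block diagonal matrices with blocks of sizes
`1` and `l - 1`, the first of which is a complex number. -/
def spIsotropy : LieSubalgebra ℝ (sp l) where
  carrier := {X | (∀ i j : Fin l, ¬ ((i : ℕ) = 0 ↔ (j : ℕ) = 0) → X.1 i j = 0) ∧
    ∀ i : Fin l, (i : ℕ) = 0 → (X.1 i i).imJ = 0 ∧ (X.1 i i).imK = 0}
  add_mem' := by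
    rintro X Y ⟨hX, hX'⟩ ⟨hY, hY'⟩
    refine ⟨fun i j h => ?_, fun i h => ?_⟩
    · simp [hX i j h, hY i j h]
    · simp [hX' i h, hY' i h]
  zero_mem' := by simp
  smul_mem' := by
    rintro r X ⟨hX, hX'⟩
    refine ⟨fun i j h => ?_, fun i h => ?_⟩
    · simp [hX i j h]
    · simp [hX' i h]
  lie_mem' := by
    have key : ∀ X Y : sp l,
        (∀ i j : Fin l, ¬ ((i : ℕ) = 0 ↔ (j : ℕ) = 0) → X.1 i j = 0) →
        (∀ i j : Fin l, ¬ ((i : ℕ) = 0 ↔ (j : ℕ) = 0) → Y.1 i j = 0) →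
        (∀ i j : Fin l, ¬ ((i : ℕ) = 0 ↔ (j : ℕ) = 0) → (X.1 * Y.1) i j = 0) ∧
        ∀ i : Fin l, (i : ℕ) = 0 → (X.1 * Y.1) i i = X.1 i i * Y.1 i i := by
      intro X Y hX hY
      refine ⟨fun i j h => ?_, fun i h => ?_⟩
      · rw [Matrix.mul_apply]
        refine Finset.sum_eq_zero fun k _ => ?_
        by_cases hk : ((i : ℕ) = 0 ↔ (k : ℕ) = 0)
        · rw [hY k j (by tauto), mul_zero]
        · rw [hX i k hk, zero_mul]
      · rw [Matrix.mul_apply]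
        refine Finset.sum_eq_single i (fun k _ hk => ?_) (by simp)
        rw [hX i k (fun hh => hk (Fin.ext ((hh.1 h).trans h.symm))), zero_mul]
    rintro X Y ⟨hX, hX'⟩ ⟨hY, hY'⟩
    have hXY := key X Y hX hY
    have hYX := key Y X hY hX
    have hb : (⁅X, Y⁆ : sp l).1 = X.1 * Y.1 - Y.1 * X.1 := rfl
    refine ⟨fun i j h => ?_, fun i h => ?_⟩
    · rw [hb, Matrix.sub_apply, hXY.1 i j h, hYX.1 i j h, sub_zero]
    · rw [hb, Matrix.sub_apply, hXY.2 i h, hYX.2 i h]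
      simp [hX' i h, hY' i h]

/-- The standard Cartan subalgebra of `sp(l)`: the matrices `diag(√-1 θ_1, …, √-1 θ_l)` with `θ_j`
real, where `√-1` is the quaternion unit `i`. -/
def spCartan : Submodule ℝ (sp l) where
  carrier := {X | ∃ θ : Fin l → ℝ,
    X.1 = Matrix.diagonal fun j => ((Complex.I * (θ j : ℂ) : ℂ) : ℍ[ℝ])}
  add_mem' := by
    rintro X Y ⟨θ, hX⟩ ⟨η, hY⟩
    refine ⟨θ + η, ?_⟩
    have h : (X + Y).1 = X.1 + Y.1 := rfl
    rw [h, hX, hY, Matrix.diagonal_add]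
    congr 1
    ext j <;> simp
  zero_mem' := by
    refine ⟨0, ?_⟩
    have h : (0 : sp l).1 = 0 := rfl
    rw [h, ← Matrix.diagonal_zero]
    congr 1
    ext j <;> simp
  smul_mem' := by
    rintro r X ⟨θ, hX⟩
    refine ⟨r • θ, ?_⟩
    have h : (r • X).1 = r • X.1 := rfl
    rw [h, hX, ← Matrix.diagonal_smul]
    congr 1
    ext j <;> simp

/-- The functional `e_j` with `e_j (diag(√-1 θ_1, …, √-1 θ_l)) = √-1 θ_j`; the roots of `sp(l)` are
`±2 e_i` and `±e_i ± e_j` with `i ≠ j`. -/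
def spCoord (j : Fin l) : Module.Dual ℂ (complexify (spCartan l)) :=
  toDual (spCartan l)
    { toFun := fun X => Complex.I * ((X.1 j j).imI : ℂ)
      map_add' := by intro X Y; simp [mul_add]
      map_smul' := by intro r X; simp; ring }

/-- The simple roots `e_1 - e_2, …, e_{l-1} - e_l, 2 e_l` of `sp(l)`. -/
def spSimple (i : Fin l) : Module.Dual ℂ (complexify (spCartan l)) :=
  if h : (i : ℕ) + 1 < l then spCoord l i - spCoord l ⟨(i : ℕ) + 1, h⟩ else 2 • spCoord l i

/-- The submodule `𝔮^m` (`m = 1, 2`) for `Sp(l)/(U(1) × Sp(l-1))`; the distinguished simple root is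
the first one, `e_1 - e_2`. -/
def spSummand (hl : 2 ≤ l) (m : ℕ) : Submodule ℝ (sp l) :=
  isotropySummand (spCartan l) (spSimple l) ⟨0, by omega⟩ m

end Symplectic

end

end FlagManifold

namespace FlagManifold

section General

variable {𝔤 : Type*} [LieRing 𝔤] [LieAlgebra ℝ 𝔤] {𝔥 : Submodule ℝ 𝔤}

/-- An element `H` of `𝔥`, viewed in `𝔥^ℂ`. -/
noncomputable def ofReal (H : 𝔥) : complexify 𝔥 :=
  ⟨1 ⊗ₜ[ℝ] (H : 𝔤), Submodule.tmul_mem_baseChange_of_mem 1 H.2⟩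

/-- The real part `𝔤^ℂ → 𝔤`. -/
noncomputable def rePart (𝔤 : Type*) [LieRing 𝔤] [LieAlgebra ℝ 𝔤] : ℂ ⊗[ℝ] 𝔤 →ₗ[ℝ] 𝔤 :=
  TensorProduct.lift (LinearMap.lsmul ℝ 𝔤 ∘ₗ Complex.reLm)

@[simp]
theorem rePart_tmul (z : ℂ) (X : 𝔤) : rePart 𝔤 (z ⊗ₜ[ℝ] X) = z.re • X := by
  simp [rePart]

theorem one_tmul_injective {X Y : 𝔤} (h : (1 : ℂ) ⊗ₜ[ℝ] X = 1 ⊗ₜ[ℝ] Y) : X = Y := by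
  simpa using congrArg (rePart 𝔤) h

theorem toDual_ofReal (f : 𝔤 →ₗ[ℝ] ℂ) (H : 𝔥) : toDual 𝔥 f (ofReal H) = f H := by
  simp [toDual, ofReal]

theorem mem_rootSpace {α : Module.Dual ℂ (complexify 𝔥)} {a : ℂ ⊗[ℝ] 𝔤} :
    a ∈ rootSpace 𝔥 α ↔ ∀ H : 𝔥, LieAlgebra.ad ℂ (ℂ ⊗[ℝ] 𝔤) (1 ⊗ₜ[ℝ] (H : 𝔤)) a = α (ofReal H) • a := by
  simp only [rootSpace, Submodule.mem_iInf, Module.End.mem_eigenspace_iff]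
  refine ⟨fun h H => h (ofReal H), fun h => ?_⟩
  rintro ⟨H, hH⟩
  have hs : complexify 𝔥 = Submodule.span ℂ (TensorProduct.mk ℝ ℂ 𝔤 1 '' (𝔥 : Set 𝔤)) :=
    Submodule.baseChange_eq_span _ _
  have hs' : H ∈ Submodule.span ℂ (TensorProduct.mk ℝ ℂ 𝔤 1 '' (𝔥 : Set 𝔤)) := hs ▸ hH
  suffices ∃ hH' : H ∈ complexify 𝔥, LieAlgebra.ad ℂ (ℂ ⊗[ℝ] 𝔤) H a = α ⟨H, hH'⟩ • a from this.2
  induction hs' using Submodule.span_induction with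
  | mem x hx =>
    obtain ⟨y, hy, rfl⟩ := hx
    exact ⟨Submodule.tmul_mem_baseChange_of_mem 1 hy, h ⟨y, hy⟩⟩
  | zero =>
    refine ⟨zero_mem _, ?_⟩
    rw [map_zero, LinearMap.zero_apply, show (⟨0, zero_mem _⟩ : complexify 𝔥) = 0 from rfl, map_zero, zero_smul]
  | add x y hx hy hx' hy' =>
    obtain ⟨h1, h1'⟩ := hx' (by rw [hs]; exact hx)
    obtain ⟨h2, h2'⟩ := hy' (by rw [hs]; exact hy)
    refine ⟨add_mem h1 h2, ?_⟩
    rw [show (⟨x + y, add_mem h1 h2⟩ : complexify 𝔥) = ⟨x, h1⟩ + ⟨y, h2⟩ from rfl, map_add,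
      map_add, LinearMap.add_apply, add_smul, h1', h2']
  | smul c x hx hx' =>
    obtain ⟨h1, h1'⟩ := hx' (by rw [hs]; exact hx)
    refine ⟨Submodule.smul_mem _ c h1, ?_⟩
    rw [show (⟨c • x, Submodule.smul_mem _ c h1⟩ : complexify 𝔥) = c • ⟨x, h1⟩ from rfl, map_smul,
      map_smul, LinearMap.smul_apply, smul_assoc, h1']

theorem mem_realRootSpace {α : Module.Dual ℂ (complexify 𝔥)} {X : 𝔤} :
    X ∈ realRootSpace 𝔥 α ↔
      ∃ a ∈ rootSpace 𝔥 α, ∃ b ∈ rootSpace 𝔥 (-α), a + b = (1 : ℂ) ⊗ₜ[ℝ] X := by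
  simp [realRootSpace, Submodule.mem_sup]

theorem one_tmul_lie (X Y : 𝔤) :
    (1 : ℂ) ⊗ₜ[ℝ] ⁅X, Y⁆ = LieAlgebra.ad ℂ (ℂ ⊗[ℝ] 𝔤) (1 ⊗ₜ[ℝ] X) (1 ⊗ₜ[ℝ] Y) := by
  simp

theorem one_tmul_smul (t : ℝ) (X : 𝔤) : (1 : ℂ) ⊗ₜ[ℝ] (t • X) = (t : ℂ) • (1 : ℂ) ⊗ₜ[ℝ] X := by
  rw [TensorProduct.smul_tmul', ← TensorProduct.smul_tmul]
  simp

theorem lie_lie_of_mem_realRootSpace {α : Module.Dual ℂ (complexify 𝔥)} {X : 𝔤}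
    (hX : X ∈ realRootSpace 𝔥 α) (H : 𝔥) {t : ℝ} (ht : α (ofReal H) = Complex.I * t) :
    ⁅(H : 𝔤), ⁅(H : 𝔤), X⁆⁆ = (-t ^ 2) • X := by
  obtain ⟨a, ha, b, hb, hab⟩ := mem_realRootSpace.1 hX
  apply one_tmul_injective
  have ha' := mem_rootSpace.1 ha H
  have hb' := mem_rootSpace.1 hb H
  rw [one_tmul_lie, one_tmul_lie, ← hab, map_add, ha', hb', map_add, map_smul, map_smul, ha', hb',
    one_tmul_smul, ← hab, ht, LinearMap.neg_apply, ht, smul_smul, smul_smul,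
    neg_mul_neg, smul_add]
  have h : Complex.I * (t : ℂ) * (Complex.I * t) = ((-t ^ 2 : ℝ) : ℂ) := by
    push_cast
    linear_combination (t : ℂ) ^ 2 * Complex.I_mul_I
  rw [h]

theorem lie_mem_realRootSpace {α : Module.Dual ℂ (complexify 𝔥)} {X : 𝔤}
    (hX : X ∈ realRootSpace 𝔥 α) (H : 𝔥) : ⁅(H : 𝔤), X⁆ ∈ realRootSpace 𝔥 α := by
  obtain ⟨a, ha, b, hb, hab⟩ := mem_realRootSpace.1 hX
  refine mem_realRootSpace.2 ⟨_, Submodule.smul_mem _ (α (ofReal H)) ha, _,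
    Submodule.smul_mem _ ((-α) (ofReal H)) hb, ?_⟩
  rw [one_tmul_lie, ← hab, map_add, mem_rootSpace.1 ha, mem_rootSpace.1 hb]

variable {ι : Type*} [Fintype ι] {simple : ι → Module.Dual ℂ (complexify 𝔥)} {p : ι} {m : ℕ}

theorem mem_isotropySummand {α : Module.Dual ℂ (complexify 𝔥)}
    (hα : α ∈ rootsOfDegree 𝔥 simple p m) {X : 𝔤} (hX : X ∈ realRootSpace 𝔥 α) :
    X ∈ isotropySummand 𝔥 simple p m :=
  Submodule.mem_iSup_of_mem α (Submodule.mem_iSup_of_mem hα hX)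

theorem isotropySummand_le {S : Submodule ℝ 𝔤}
    (h : ∀ α ∈ rootsOfDegree 𝔥 simple p m, ∀ X ∈ realRootSpace 𝔥 α, X ∈ S) :
    isotropySummand 𝔥 simple p m ≤ S :=
  iSup₂_le h

theorem lie_mem_isotropySummand (H : 𝔥) {X : 𝔤} (hX : X ∈ isotropySummand 𝔥 simple p m) :
    ⁅(H : 𝔤), X⁆ ∈ isotropySummand 𝔥 simple p m :=
  isotropySummand_le
    (S := (isotropySummand 𝔥 simple p m).comap (LieAlgebra.ad ℝ 𝔤 (H : 𝔤)))
    (fun _ hα _ hY => mem_isotropySummand hα (lie_mem_realRootSpace hY H)) hX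

/-- If `H ∈ 𝔥` is annihilated by all simple roots but the distinguished one, then `(ad H)^2` is a
scalar on `𝔮^m`. -/
theorem lie_lie_of_mem_isotropySummand (H : 𝔥) {t : ℝ} (hp : simple p (ofReal H) = Complex.I * t)
    (h0 : ∀ i, i ≠ p → simple i (ofReal H) = 0) {X : 𝔤}
    (hX : X ∈ isotropySummand 𝔥 simple p m) :
    ⁅(H : 𝔤), ⁅(H : 𝔤), X⁆⁆ = (-(m * t) ^ 2) • X := by
  have key : isotropySummand 𝔥 simple p m ≤
      LinearMap.eqLocus ((LieAlgebra.ad ℝ 𝔤 (H : 𝔤)) ∘ₗ (LieAlgebra.ad ℝ 𝔤 (H : 𝔤)))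
        ((-(m * t) ^ 2) • LinearMap.id) := by
    refine isotropySummand_le ?_
    rintro α ⟨-, c, rfl, hc⟩ Y hY
    refine lie_lie_of_mem_realRootSpace hY H ?_
    rw [LinearMap.sum_apply, Finset.sum_eq_single p]
    · rw [LinearMap.smul_apply, hp, hc, nsmul_eq_mul]
      push_cast
      ring
    · intro i _ hi
      rw [LinearMap.smul_apply, h0 i hi, smul_zero]
    · simp
  exact key hX

theorem lie_ne_zero_and_mem (H : 𝔥) {t : ℝ} (ht : t ≠ 0) (hm : m ≠ 0)
    (hp : simple p (ofReal H) = Complex.I * t)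
    (h0 : ∀ i, i ≠ p → simple i (ofReal H) = 0) {X : 𝔤}
    (hX : X ∈ isotropySummand 𝔥 simple p m) (hX0 : X ≠ 0) :
    ⁅(H : 𝔤), X⁆ ≠ 0 ∧ ⁅(H : 𝔤), X⁆ ∈ isotropySummand 𝔥 simple p m := by
  refine ⟨fun h => ?_, lie_mem_isotropySummand H hX⟩
  have := lie_lie_of_mem_isotropySummand H hp h0 hX
  rw [h, lie_zero, eq_comm, smul_eq_zero] at this
  simp [hm, ht, hX0] at this

/-- A real two-dimensional subspace on which `𝔥` acts by rotations with speed `t ≠ 0` is contained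
in the real root space of `√-1 t`. -/
theorem mem_realRootSpace_of_rotation {α : Module.Dual ℂ (complexify 𝔥)} {t : 𝔥 → ℝ}
    (ht : ∀ H, α (ofReal H) = Complex.I * t H) {X Y : 𝔤}
    (hX : ∀ H : 𝔥, ⁅(H : 𝔤), X⁆ = t H • Y) (hY : ∀ H : 𝔥, ⁅(H : 𝔤), Y⁆ = -t H • X)
    (hX0 : X ≠ 0) {H₀ : 𝔥} (hH₀ : t H₀ ≠ 0) :
    α ∈ roots 𝔥 ∧ X ∈ realRootSpace 𝔥 α := by
  have hXC : ∀ H : 𝔥, LieAlgebra.ad ℂ (ℂ ⊗[ℝ] 𝔤) (1 ⊗ₜ[ℝ] (H : 𝔤)) (1 ⊗ₜ[ℝ] X) =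
       (t H : ℂ) • (1 : ℂ) ⊗ₜ[ℝ] Y := by
    intro H
    rw [← one_tmul_lie, hX, one_tmul_smul]
  have hYC : ∀ H : 𝔥,
      LieAlgebra.ad ℂ (ℂ ⊗[ℝ] 𝔤) (1 ⊗ₜ[ℝ] (H : 𝔤)) (1 ⊗ₜ[ℝ] Y) =
       -(t H : ℂ) • (1 : ℂ) ⊗ₜ[ℝ] X := by
    intro H
    rw [← one_tmul_lie, hY, one_tmul_smul, Complex.ofReal_neg]
  have h1 : (1 : ℂ) ⊗ₜ[ℝ] X - Complex.I • (1 : ℂ) ⊗ₜ[ℝ] Y ∈ rootSpace 𝔥 α := by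
    refine mem_rootSpace.2 fun H => ?_
    rw [map_sub, map_smul, hXC, hYC, ht]
    match_scalars
    · linear_combination (t H : ℂ) * Complex.I_mul_I
    · ring
  have h2 : (1 : ℂ) ⊗ₜ[ℝ] X + Complex.I • (1 : ℂ) ⊗ₜ[ℝ] Y ∈ rootSpace 𝔥 (-α) := by
    refine mem_rootSpace.2 fun H => ?_
    rw [map_add, map_smul, hXC, hYC, LinearMap.neg_apply, ht]
    match_scalars
    · linear_combination (t H : ℂ) * Complex.I_mul_I
    · ring
  refine ⟨⟨?_, ?_⟩, ?_⟩
  · rintro rfl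
    simpa [hH₀] using ht H₀
  · intro h
    rw [h, Submodule.mem_bot] at h1
    have := congrArg (rePart 𝔤) h1
    simp [TensorProduct.smul_tmul', hX0] at this
  · refine mem_realRootSpace.2 ⟨_, Submodule.smul_mem _ (1 / 2) h1, _,
      Submodule.smul_mem _ (1 / 2) h2, ?_⟩
    match_scalars <;> ring

theorem bracketSpan_ne_bot {𝔞 𝔟 : Submodule ℝ 𝔤} {X Y : 𝔤} (hX : X ∈ 𝔞) (hY : Y ∈ 𝔟)
    (h : ⁅X, Y⁆ ≠ 0) : bracketSpan 𝔞 𝔟 ≠ ⊥ := by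
  intro hb
  have : ⁅X, Y⁆ ∈ bracketSpan 𝔞 𝔟 := Submodule.subset_span ⟨X, hX, Y, hY, rfl⟩
  rw [hb, Submodule.mem_bot] at this
  exact h this

end General

section OddOrthogonal

open Matrix

variable {l : ℕ}

/-- The index of the coordinate `x_j` of `ℝ^{2l+1} = ℂ^l ⊕ ℝ`. -/
abbrev soRe (j : Fin l) : SOIndex l := Sum.inl (Sum.inl j)

/-- The index of the coordinate `y_j` of `ℝ^{2l+1} = ℂ^l ⊕ ℝ`. -/
abbrev soIm (j : Fin l) : SOIndex l := Sum.inl (Sum.inr j)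

/-- The index of the last coordinate of `ℝ^{2l+1} = ℂ^l ⊕ ℝ`. -/
abbrev soLast : SOIndex l := Sum.inr ()

theorem realify_injective : Function.Injective (realify (l := l)) := by
  intro Z W h
  ext i j
  apply Complex.ext
  · simpa [realify] using congrFun (congrFun h (soRe i)) (soRe j)
  · simpa [realify] using congrFun (congrFun h (soIm i)) (soRe j)

/-- The matrix `diag(√-1 θ_1, …, √-1 θ_l)`, as a real matrix. -/
noncomputable def soDiag (θ : Fin l → ℝ) : Matrix (SOIndex l) (SOIndex l) ℝ :=
  realify (Matrix.diagonal fun j => Complex.I * (θ j : ℂ))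

theorem soDiag_mul_single_re (θ : Fin l → ℝ) (j : Fin l) (k : SOIndex l) :
    soDiag θ * single (soRe j) k 1 = θ j • single (soIm j) k 1 := by
  ext ((a | a) | a) b <;> simp [mul_apply, soDiag, realify, single_apply, diagonal_apply, ite_and]
  aesop

theorem soDiag_mul_single_im (θ : Fin l → ℝ) (j : Fin l) (k : SOIndex l) :
    soDiag θ * single (soIm j) k 1 = -θ j • single (soRe j) k 1 := by
  ext ((a | a) | a) b <;> simp [mul_apply, soDiag, realify, single_apply, diagonal_apply, ite_and]
  aesop

theorem soDiag_mul_single_last (θ : Fin l → ℝ) (k : SOIndex l) :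
    soDiag θ * single soLast k 1 = 0 := by
  ext ((a | a) | a) b <;> simp [mul_apply, soDiag, realify, single_apply, ite_and]

theorem single_re_mul_soDiag (θ : Fin l → ℝ) (j : Fin l) (k : SOIndex l) :
    single k (soRe j) 1 * soDiag θ = -θ j • single k (soIm j) 1 := by
  ext a ((b | b) | b) <;> simp [mul_apply, soDiag, realify, single_apply, diagonal_apply, ite_and]

theorem single_im_mul_soDiag (θ : Fin l → ℝ) (j : Fin l) (k : SOIndex l) :
    single k (soIm j) 1 * soDiag θ = θ j • single k (soRe j) 1 := by
  ext a ((b | b) | b) <;> simp [mul_apply, soDiag, realify, single_apply, diagonal_apply, ite_and]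

theorem single_last_mul_soDiag (θ : Fin l → ℝ) (k : SOIndex l) :
    single k soLast 1 * soDiag θ = 0 := by
  ext a ((b | b) | b) <;> simp [mul_apply, soDiag, realify, single_apply, ite_and]

/-- The angles `θ_j` of an element `diag(√-1 θ_1, …, √-1 θ_l)` of the Cartan subalgebra. -/
def soAngle (H : soCartan l) (j : Fin l) : ℝ := H.1.1 (soIm j) (soRe j)

theorem soAngle_eq {H : soCartan l} {θ : Fin l → ℝ} (h : H.1.1 = soDiag θ) : soAngle H = θ := by
  ext j
  rw [soAngle, h]
  simp [soDiag, realify]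

theorem soCartan_coe (H : soCartan l) : H.1.1 = soDiag (soAngle H) := by
  obtain ⟨θ, hθ⟩ := H.2
  rw [soAngle_eq hθ]
  exact hθ

theorem soCoord_ofReal (H : soCartan l) (j : Fin l) :
    soCoord l j (ofReal H) = Complex.I * soAngle H j :=
  toDual_ofReal _ _

theorem exists_soAngle_eq (θ : Fin l → ℝ) : ∃ H : soCartan l, soAngle H = θ := by
  have hs : soDiag θ ∈ so l := by
    rw [LieAlgebra.Orthogonal.mem_so]
    ext ((i | i) | i) ((j | j) | j) <;> simp [soDiag, realify, diagonal_apply, eq_comm] <;> aesop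
  exact ⟨⟨⟨soDiag θ, hs⟩, θ, rfl⟩, soAngle_eq rfl⟩

theorem so_lie_coe (X Y : so l) : (⁅X, Y⁆ : so l).1 = X.1 * Y.1 - Y.1 * X.1 := rfl

theorem so_smul_coe (r : ℝ) (X : so l) : (r • X).1 = r • X.1 := rfl

theorem so_add_coe (X Y : so l) : (X + Y).1 = X.1 + Y.1 := rfl

theorem so_sub_coe (X Y : so l) : (X - Y).1 = X.1 - Y.1 := rfl

theorem so_ext {X Y : so l} (h : X.1 = Y.1) : X = Y := Subtype.ext h

/-- The matrix `E_{a b} - E_{b a}`. -/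
def soElem (a b : SOIndex l) : so l :=
  ⟨single a b 1 - single b a 1, by
    rw [LieAlgebra.Orthogonal.mem_so]
    simp⟩

theorem soElem_coe (a b : SOIndex l) : (soElem a b).1 = single a b 1 - single b a 1 := rfl

theorem lie_soElem_re_last (H : soCartan l) (q : Fin l) :
    ⁅(H : so l), soElem (soRe q) soLast⁆ = soAngle H q • soElem (soIm q) soLast := by
  apply so_ext
  rw [so_lie_coe, soCartan_coe, so_smul_coe, soElem_coe, soElem_coe, mul_sub, sub_mul,
    soDiag_mul_single_re, soDiag_mul_single_last, single_re_mul_soDiag, single_last_mul_soDiag]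
  module

theorem lie_soElem_im_last (H : soCartan l) (q : Fin l) :
    ⁅(H : so l), soElem (soIm q) soLast⁆ = -soAngle H q • soElem (soRe q) soLast := by
  apply so_ext
  rw [so_lie_coe, soCartan_coe, so_smul_coe, soElem_coe, soElem_coe, mul_sub, sub_mul,
    soDiag_mul_single_im, soDiag_mul_single_last, single_im_mul_soDiag, single_last_mul_soDiag]
  module

theorem lie_soElem_sum_re (H : soCartan l) (p q : Fin l) :
    ⁅(H : so l), soElem (soRe p) (soRe q) - soElem (soIm p) (soIm q)⁆ =
      (soAngle H p + soAngle H q) •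
        (soElem (soRe p) (soIm q) + soElem (soIm p) (soRe q)) := by
  apply so_ext
  rw [so_lie_coe, soCartan_coe, so_smul_coe, so_sub_coe,
    so_add_coe]
  simp only [soElem_coe, mul_sub, sub_mul, soDiag_mul_single_re, soDiag_mul_single_im,
    single_re_mul_soDiag, single_im_mul_soDiag]
  module

theorem lie_soElem_sum_im (H : soCartan l) (p q : Fin l) :
    ⁅(H : so l), soElem (soRe p) (soIm q) + soElem (soIm p) (soRe q)⁆ =
      -(soAngle H p + soAngle H q) •
        (soElem (soRe p) (soRe q) - soElem (soIm p) (soIm q)) := by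
  apply so_ext
  rw [so_lie_coe, soCartan_coe, so_smul_coe, so_sub_coe,
    so_add_coe]
  simp only [soElem_coe, mul_sub, sub_mul, mul_add, add_mul, soDiag_mul_single_re,
    soDiag_mul_single_im, single_re_mul_soDiag, single_im_mul_soDiag]
  module

theorem soElem_re_last_mem (hl : 2 ≤ l) :
    soElem (soRe ⟨l - 1, by omega⟩) soLast ∈ soSummand l hl 1 := by
  set q : Fin l := ⟨l - 1, by omega⟩ with hq
  obtain ⟨H₀, hH₀⟩ := exists_soAngle_eq (l := l) 1
  have h := mem_realRootSpace_of_rotation (α := soCoord l q) (t := fun H => soAngle H q)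
    (fun H => soCoord_ofReal H q) (fun H => lie_soElem_re_last H q)
    (fun H => lie_soElem_im_last H q)
    (fun h => by simpa [soElem] using congrFun (congrFun (congrArg Subtype.val h) (soRe q)) soLast)
    (H₀ := H₀) (by simp [hH₀])
  refine mem_isotropySummand ⟨h.1, Pi.single q 1, ?_, by simp [q]⟩ h.2
  rw [Finset.sum_eq_single q (fun i _ hi => by simp [hi]) (by simp), Pi.single_eq_same, one_smul,
    soSimple, dif_neg (by simp [q]; omega)]

theorem soElem_re_re_sub_mem (hl : 2 ≤ l) :
    soElem (soRe ⟨l - 2, by omega⟩) (soRe ⟨l - 1, by omega⟩) -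
      soElem (soIm ⟨l - 2, by omega⟩) (soIm ⟨l - 1, by omega⟩) ∈ soSummand l hl 2 := by
  set q : Fin l := ⟨l - 1, by omega⟩ with hq
  set p : Fin l := ⟨l - 2, by omega⟩ with hp
  have hpq : p ≠ q := by simp [p, q]; omega
  obtain ⟨H₀, hH₀⟩ := exists_soAngle_eq (l := l) 1
  have h := mem_realRootSpace_of_rotation (α := soCoord l p + soCoord l q)
    (t := fun H => soAngle H p + soAngle H q)
    (fun H => by rw [LinearMap.add_apply, soCoord_ofReal, soCoord_ofReal]; push_cast; ring)
    (fun H => lie_soElem_sum_re H p q) (fun H => lie_soElem_sum_im H p q)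
    (fun h => by
      simpa [soElem, hpq, hpq.symm] using
        congrFun (congrFun (congrArg Subtype.val h) (soRe p)) (soRe q))
    (H₀ := H₀) (by norm_num [hH₀])
  refine mem_isotropySummand ⟨h.1, Pi.single p 1 + Pi.single q 2, ?_, ?_⟩ h.2
  · rw [Fintype.sum_eq_add p q hpq (fun i hi => by simp [hi.1, hi.2])]
    have h1 : soSimple l p = soCoord l p - soCoord l q := by
      rw [soSimple, dif_pos (by simp [p]; omega)]
      congr 2
      simp [p, q]
      omega
    have h2 : soSimple l q = soCoord l q := by
      rw [soSimple, dif_neg (by simp [q]; omega)]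
    rw [h1, h2]
    simp [hpq, hpq.symm, two_smul]
  · simp [← hq, hpq.symm]

theorem soElem_lie_ne_zero {p q : Fin l} (hpq : p ≠ q) :
    ⁅soElem (soRe q) soLast, soElem (soRe p) (soRe q) - soElem (soIm p) (soIm q)⁆ ≠ 0 := by
  intro h
  have := congrFun (congrFun (congrArg Subtype.val h) (soRe p)) soLast
  rw [so_lie_coe, so_sub_coe] at this
  simp [soElem_coe, mul_sub, sub_mul, hpq, hpq.symm] at this

/-- The center of `𝔲(l)` consists of the multiples of `√-1`. -/
theorem soIsotropy_center {ξ : soIsotropy l} (hξ : ξ ∈ LieAlgebra.center ℝ (soIsotropy l)) :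
    ∃ c : ℝ, ξ.1.1 = soDiag fun _ => c := by
  obtain ⟨Z, hZ, hξZ⟩ := ξ.2
  have hskew : ∀ W : Matrix (Fin l) (Fin l) ℂ, W.conjTranspose = -W → realify W ∈ so l := by
    intro W hW
    rw [LieAlgebra.Orthogonal.mem_so]
    have h : ∀ i j, (W j i).re = -(W i j).re ∧ (W j i).im = (W i j).im := fun i j => by
      have := congrFun (congrFun hW i) j
      simp only [conjTranspose_apply, Complex.ext_iff] at this
      simpa using this
    ext ((i | i) | i) ((j | j) | j) <;> simp [realify]
    · exact (h i j).1
    · exact (h i j).2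
    · exact (h i j).2
    · exact (h i j).1
  have hcomm : ∀ W : Matrix (Fin l) (Fin l) ℂ, W.conjTranspose = -W → W * Z = Z * W := by
    intro W hW
    have h := (LieModule.mem_maxTrivSubmodule (R := ℝ) (L := soIsotropy l) _ _).1 hξ
      ⟨⟨realify W, hskew W hW⟩, W, hW, rfl⟩
    have h' : realify W * ξ.1.1 - ξ.1.1 * realify W = 0 :=
      congrArg (fun x : soIsotropy l => x.1.1) h
    rw [hξZ, ← realify_mul, ← realify_mul, sub_eq_zero] at h'
    exact realify_injective h'
  have hoff : ∀ j k, j ≠ k → Z j k = 0 := by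
    intro j k hjk
    have h := congrFun (congrFun (hcomm (single j j Complex.I) (by simp [single_neg])) j) k
    simpa [hjk, hjk.symm] using h
  have hdiag : ∀ j k, Z j j = Z k k := by
    intro j k
    rcases eq_or_ne j k with rfl | hjk
    · rfl
    have h := congrFun (congrFun (hcomm (single j k 1 - single k j 1) (by simp)) j) k
    simpa [mul_sub, sub_mul, hjk, hjk.symm] using h.symm
  have him : ∀ j, Z j j = Complex.I * ((Z j j).im : ℂ) := by
    intro j
    have h := congrArg Complex.re (congrFun (congrFun hZ j) j)
    simp at h
    apply Complex.ext <;> simp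
    linarith
  rcases isEmpty_or_nonempty (Fin l) with hl | ⟨⟨j⟩⟩
  · refine ⟨0, ?_⟩
    rw [hξZ, soDiag]
    congr 1
    ext i
    exact hl.elim i
  · refine ⟨(Z j j).im, ?_⟩
    rw [hξZ, soDiag]
    congr 1
    ext a b
    rcases eq_or_ne a b with rfl | hab
    · rw [diagonal_apply_eq, hdiag a j, ← him]
    · rw [diagonal_apply_ne _ hab, hoff a b hab]

theorem lie_soSummand_two (hl : 2 ≤ l) {ξ : soIsotropy l}
    (hξ : ξ ∈ LieAlgebra.center ℝ (soIsotropy l)) (hξ0 : ξ ≠ 0) {X : so l}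
    (hX : X ∈ soSummand l hl 2) (hX0 : X ≠ 0) :
    ⁅(ξ : so l), X⁆ ≠ 0 ∧ ⁅(ξ : so l), X⁆ ∈ soSummand l hl 2 := by
  obtain ⟨c, hc⟩ := soIsotropy_center hξ
  have hang : soAngle ⟨ξ.1, _, hc⟩ = fun _ => c := soAngle_eq hc
  have hc0 : c ≠ 0 := by
    rintro rfl
    refine hξ0 (Subtype.ext (so_ext (hc.trans ?_)))
    ext ((i | i) | i) ((j | j) | j) <;> simp [soDiag, realify]
  refine lie_ne_zero_and_mem (𝔥 := soCartan l) ⟨ξ.1, _, hc⟩ hc0 two_ne_zero ?_ ?_ hX hX0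
  · rw [soSimple, dif_neg (by simp; omega), soCoord_ofReal, hang]
  · intro i hi
    rw [soSimple, dif_pos, LinearMap.sub_apply, soCoord_ofReal, soCoord_ofReal, hang, sub_self]
    by_contra h
    exact hi (Fin.ext (by simp; omega))

end OddOrthogonal

section Symplectic

open Matrix

variable {l : ℕ}

/-- The quaternion `a + b i + c j + d k`. -/
def quat (a b c d : ℝ) : ℍ[ℝ] := ⟨a, b, c, d⟩

@[simp] theorem quat_re (a b c d : ℝ) : (quat a b c d).re = a := rfl

@[simp] theorem quat_imI (a b c d : ℝ) : (quat a b c d).imI = b := rfl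

@[simp] theorem quat_imJ (a b c d : ℝ) : (quat a b c d).imJ = c := rfl

@[simp] theorem quat_imK (a b c d : ℝ) : (quat a b c d).imK = d := rfl

/-- The matrix `diag(√-1 θ_1, …, √-1 θ_l)` with quaternionic entries. -/
noncomputable def spDiag (θ : Fin l → ℝ) : Matrix (Fin l) (Fin l) ℍ[ℝ] :=
  Matrix.diagonal fun j => quat 0 (θ j) 0 0

theorem coe_I_mul (t : ℝ) : ((Complex.I * (t : ℂ) : ℂ) : ℍ[ℝ]) = quat 0 t 0 0 := by
  ext <;> simp

theorem spDiag_mul_single (θ : Fin l → ℝ) (j k : Fin l) (x : ℍ[ℝ]) :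
    spDiag θ * single j k x = single j k (quat 0 (θ j) 0 0 * x) := by
  ext1 a b
  rw [spDiag, diagonal_mul, single_apply, single_apply]
  split_ifs with h
  · rw [h.1]
  · rw [mul_zero]

theorem single_mul_spDiag (θ : Fin l → ℝ) (j k : Fin l) (x : ℍ[ℝ]) :
    single j k x * spDiag θ = single j k (x * quat 0 (θ k) 0 0) := by
  ext1 a b
  rw [spDiag, mul_diagonal, single_apply, single_apply]
  split_ifs with h
  · rw [h.2]
  · rw [zero_mul]

/-- The angles `θ_j` of an element `diag(√-1 θ_1, …, √-1 θ_l)` of the Cartan subalgebra. -/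
def spAngle (H : spCartan l) (j : Fin l) : ℝ := (H.1.1 j j).imI

theorem spAngle_eq {H : spCartan l} {θ : Fin l → ℝ} (h : H.1.1 = spDiag θ) : spAngle H = θ := by
  ext j
  rw [spAngle, h]
  simp [spDiag]

theorem mem_spCartan {X : sp l} : X ∈ spCartan l ↔ ∃ θ, X.1 = spDiag θ := by
  change (∃ θ : Fin l → ℝ, _) ↔ _
  simp only [coe_I_mul]
  rfl

theorem spCartan_coe (H : spCartan l) : H.1.1 = spDiag (spAngle H) := by
  obtain ⟨θ, hθ⟩ := mem_spCartan.1 H.2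
  rw [spAngle_eq hθ]
  exact hθ

theorem spCoord_ofReal (H : spCartan l) (j : Fin l) :
    spCoord l j (ofReal H) = Complex.I * spAngle H j :=
  toDual_ofReal _ _

theorem mem_sp {X : Matrix (Fin l) (Fin l) ℍ[ℝ]} : X ∈ sp l ↔ X.conjTranspose = -X := Iff.rfl

theorem exists_spAngle_eq (θ : Fin l → ℝ) : ∃ H : spCartan l, spAngle H = θ := by
  have hs : spDiag θ ∈ sp l := by
    rw [mem_sp, spDiag, diagonal_conjTranspose, diagonal_neg]
    congr 1
    ext j <;> simp
  exact ⟨⟨⟨spDiag θ, hs⟩, mem_spCartan.2 ⟨θ, rfl⟩⟩, spAngle_eq rfl⟩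

theorem sp_lie_coe (X Y : sp l) : (⁅X, Y⁆ : sp l).1 = X.1 * Y.1 - Y.1 * X.1 := rfl

theorem sp_smul_coe (r : ℝ) (X : sp l) : (r • X).1 = r • X.1 := rfl

theorem sp_ext {X Y : sp l} (h : X.1 = Y.1) : X = Y := Subtype.ext h

/-- The matrix `x E_{j k} - x̄ E_{k j}`. -/
noncomputable def spElem (j k : Fin l) (x : ℍ[ℝ]) : sp l :=
  ⟨single j k x - single k j (star x), by simp [mem_sp]⟩

theorem spElem_coe (j k : Fin l) (x : ℍ[ℝ]) :
    (spElem j k x).1 = single j k x - single k j (star x) := rfl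

theorem smul_spElem (r : ℝ) (j k : Fin l) (x : ℍ[ℝ]) : r • spElem j k x = spElem j k (r • x) := by
  apply sp_ext
  rw [sp_smul_coe, spElem_coe, spElem_coe, Quaternion.star_smul, smul_sub, smul_single,
    smul_single]

theorem lie_spElem (H : spCartan l) (j k : Fin l) (x : ℍ[ℝ]) :
    ⁅(H : sp l), spElem j k x⁆ =
      spElem j k (quat 0 (spAngle H j) 0 0 * x - x * quat 0 (spAngle H k) 0 0) := by
  have h : ∀ t : ℝ, star (quat 0 t 0 0) = -quat 0 t 0 0 := fun t => by ext <;> simp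
  have hs : ∀ (a b : Fin l) (y z : ℍ[ℝ]), single a b (y - z) = single a b y - single a b z :=
    fun a b y z => by rw [sub_eq_add_neg, single_add, ← single_neg, sub_eq_add_neg]
  apply sp_ext
  rw [sp_lie_coe, spCartan_coe, spElem_coe, spElem_coe, mul_sub, sub_mul, spDiag_mul_single,
    spDiag_mul_single, single_mul_spDiag, single_mul_spDiag, star_sub, star_mul, star_mul, h, h,
    hs, hs, mul_neg, neg_mul, ← single_neg, ← single_neg]
  abel

theorem spElem_zero_one_mem (hl : 2 ≤ l) :
    spElem ⟨0, by omega⟩ ⟨1, by omega⟩ 1 ∈ spSummand l hl 1 := by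
  set p : Fin l := ⟨0, by omega⟩ with hp
  set q : Fin l := ⟨1, by omega⟩ with hq
  have hpq : p ≠ q := by simp [p, q]
  obtain ⟨H₀, hH₀⟩ := exists_spAngle_eq (Pi.single p 1)
  have h := mem_realRootSpace_of_rotation (α := spCoord l p - spCoord l q)
    (X := spElem p q 1) (Y := spElem p q (quat 0 1 0 0))
    (t := fun H => spAngle H p - spAngle H q)
    (fun H => by rw [LinearMap.sub_apply, spCoord_ofReal, spCoord_ofReal]; push_cast; ring)
    (fun H => by
      rw [lie_spElem, smul_spElem]
      congr 1
      ext <;> simp)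
    (fun H => by
      rw [lie_spElem, smul_spElem]
      congr 1
      ext <;> simp
      ring)
    (fun h => by
      simpa [spElem_coe, hpq, hpq.symm] using congrFun (congrFun (congrArg Subtype.val h) p) q)
    (H₀ := H₀) (by simp [hH₀, hpq.symm])
  refine mem_isotropySummand ⟨h.1, Pi.single p 1, ?_, by simp [p]⟩ h.2
  rw [Finset.sum_eq_single p (fun i _ hi => by simp [hi]) (by simp), Pi.single_eq_same, one_smul,
    spSimple, dif_pos (by simp [p]; omega)]

theorem two_smul_spCoord_zero (hl : 2 ≤ l) :
    2 • spCoord l ⟨0, by omega⟩ =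
      ∑ i : Fin l, (if (i : ℕ) + 1 < l then 2 else 1 : ℕ) • spSimple l i := by
  let f : ℕ → Module.Dual ℂ (complexify (spCartan l)) :=
    fun i => if h : i < l then 2 • spCoord l ⟨i, h⟩ else 0
  have h : ∀ i : Fin l, (if (i : ℕ) + 1 < l then 2 else 1 : ℕ) • spSimple l i =
      f i - f (i + 1) := by
    intro i
    by_cases hi : (i : ℕ) + 1 < l
    · simp only [f, spSimple, hi, i.2, if_true, dif_pos, smul_sub]
    · simp only [f, spSimple, hi, i.2, if_false, dif_pos, dif_neg, not_false_iff, one_smul,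
        sub_zero]
  rw [Finset.sum_congr rfl fun i _ => h i, Fin.sum_univ_eq_sum_range (fun i => f i - f (i + 1)) l,
    Finset.sum_range_sub']
  simp [f, show 0 < l by omega]

theorem spElem_zero_zero_mem (hl : 2 ≤ l) :
    spElem ⟨0, by omega⟩ ⟨0, by omega⟩ (quat 0 0 1 0) ∈ spSummand l hl 2 := by
  set p : Fin l := ⟨0, by omega⟩ with hp
  obtain ⟨H₀, hH₀⟩ := exists_spAngle_eq (l := l) 1
  have h := mem_realRootSpace_of_rotation (α := 2 • spCoord l p)
    (X := spElem p p (quat 0 0 1 0)) (Y := spElem p p (quat 0 0 0 1))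
    (t := fun H => 2 * spAngle H p)
    (fun H => by rw [LinearMap.smul_apply, spCoord_ofReal, nsmul_eq_mul]; push_cast; ring)
    (fun H => by
      rw [lie_spElem, smul_spElem]
      congr 1
      ext <;> simp
      ring)
    (fun H => by
      rw [lie_spElem, smul_spElem]
      congr 1
      ext <;> simp
      ring)
    (fun h => by
      have := congrArg QuaternionAlgebra.imJ (congrFun (congrFun (congrArg Subtype.val h) p) p)
      norm_num [spElem_coe] at this)
    (H₀ := H₀) (by simp [hH₀])
  exact mem_isotropySummand ⟨h.1, _, two_smul_spCoord_zero hl, if_pos (by simp; omega)⟩ h.2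

theorem spElem_lie_ne_zero {p q : Fin l} (hpq : p ≠ q) :
    ⁅spElem p q 1, spElem p p (quat 0 0 1 0)⁆ ≠ 0 := by
  intro h
  have := congrArg QuaternionAlgebra.imJ (congrFun (congrFun (congrArg Subtype.val h) p) q)
  rw [sp_lie_coe] at this
  norm_num [spElem_coe, mul_sub, sub_mul, hpq, hpq.symm] at this

/-- The center of `𝔲(1) ⊕ 𝔰𝔭(l-1)` is `𝔲(1)`. -/
theorem spIsotropy_center {ξ : spIsotropy l} (hξ : ξ ∈ LieAlgebra.center ℝ (spIsotropy l)) :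
    ∃ c : ℝ, ξ.1.1 = spDiag fun j => if (j : ℕ) = 0 then c else 0 := by
  obtain ⟨hblock, hfirst⟩ := ξ.2
  have hcomm : ∀ j : Fin l, (j : ℕ) ≠ 0 → ∀ x : ℍ[ℝ], star x = -x →
      single j j x * ξ.1.1 = ξ.1.1 * single j j x := by
    intro j hj x hx
    have hs : single j j x ∈ sp l := by simp [mem_sp, hx, single_neg]
    have hk : (⟨single j j x, hs⟩ : sp l) ∈ spIsotropy l := by
      refine ⟨fun a b hab => ?_, fun a ha => ?_⟩
      · refine single_apply_of_ne _ _ _ _ _ ?_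
        rintro ⟨rfl, rfl⟩
        exact hab Iff.rfl
      · have : single j j x a a = 0 := by
          refine single_apply_of_ne _ _ _ _ _ ?_
          rintro ⟨rfl, -⟩
          exact hj ha
        simp [this]
    have h := (LieModule.mem_maxTrivSubmodule (R := ℝ) (L := spIsotropy l) _ _).1 hξ ⟨_, hk⟩
    have h' : single j j x * ξ.1.1 - ξ.1.1 * single j j x = 0 :=
      congrArg (fun x : spIsotropy l => x.1.1) h
    exact sub_eq_zero.1 h'
  have hskew : ∀ j k, star (ξ.1.1 k j) = -ξ.1.1 j k := fun j k =>
    congrFun (congrFun ξ.1.2 j) k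
  have hre : ∀ j, (ξ.1.1 j j).re = 0 := by
    intro j
    have h := congrArg QuaternionAlgebra.re (hskew j j)
    simp at h
    linarith
  have hI : star (quat 0 1 0 0) = -quat 0 1 0 0 := by ext <;> simp
  have hJ : star (quat 0 0 1 0) = -quat 0 0 1 0 := by ext <;> simp
  have hoff : ∀ j k : Fin l, (j : ℕ) ≠ 0 → j ≠ k → ξ.1.1 j k = 0 := by
    intro j k hj hjk
    have h := congrFun (congrFun (hcomm j hj _ hI) j) k
    rw [single_mul_apply_same, mul_single_apply_of_ne _ _ _ _ _ hjk.symm] at h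
    refine (mul_eq_zero.1 h).resolve_left fun h0 => ?_
    simpa using congrArg QuaternionAlgebra.imI h0
  have hdiag : ∀ j : Fin l, (j : ℕ) ≠ 0 → ξ.1.1 j j = 0 := by
    intro j hj
    have h1 := congrFun (congrFun (hcomm j hj _ hI) j) j
    have h2 := congrFun (congrFun (hcomm j hj _ hJ) j) j
    rw [single_mul_apply_same, mul_single_apply_same] at h1 h2
    simp only [Quaternion.ext_iff, Quaternion.re_mul, Quaternion.imI_mul, Quaternion.imJ_mul,
      Quaternion.imK_mul, quat_re, quat_imI, quat_imJ, quat_imK] at h1 h2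
    have := hre j
    ext <;> simp <;> linarith [h1.2.2.1, h1.2.2.2, h2.2.1, h2.2.2.2]
  have hentry : ∀ a b : Fin l, a ≠ b → ξ.1.1 a b = 0 := by
    intro a b hab
    by_cases ha : (a : ℕ) = 0
    · exact hblock a b fun h => hab (Fin.ext (ha.trans (h.1 ha).symm))
    · exact hoff a b ha hab
  by_cases hl : 0 < l
  · refine ⟨(ξ.1.1 ⟨0, hl⟩ ⟨0, hl⟩).imI, ?_⟩
    ext1 a b
    rcases eq_or_ne a b with rfl | hab
    · rw [spDiag, diagonal_apply_eq]
      by_cases ha : (a : ℕ) = 0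
      · obtain rfl : a = ⟨0, hl⟩ := Fin.ext ha
        have := hfirst _ ha
        ext <;> simp [hre, this.1, this.2]
      · rw [hdiag a ha]
        ext <;> simp [ha]
    · rw [hentry a b hab, spDiag, diagonal_apply_ne _ hab]
  · refine ⟨0, ?_⟩
    ext1 a
    exact absurd a.pos hl

theorem lie_spSummand_two (hl : 2 ≤ l) {ξ : spIsotropy l}
    (hξ : ξ ∈ LieAlgebra.center ℝ (spIsotropy l)) (hξ0 : ξ ≠ 0) {X : sp l}
    (hX : X ∈ spSummand l hl 2) (hX0 : X ≠ 0) :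
    ⁅(ξ : sp l), X⁆ ≠ 0 ∧ ⁅(ξ : sp l), X⁆ ∈ spSummand l hl 2 := by
  obtain ⟨c, hc⟩ := spIsotropy_center hξ
  have hang : spAngle ⟨ξ.1, mem_spCartan.2 ⟨_, hc⟩⟩ = fun j : Fin l => if (j : ℕ) = 0 then c else 0 :=
    spAngle_eq hc
  have hc0 : c ≠ 0 := by
    rintro rfl
    refine hξ0 (Subtype.ext (sp_ext (hc.trans ?_)))
    ext1 i j
    simp only [ite_self, spDiag]
    exact congrFun (congrFun diagonal_zero i) j
  refine lie_ne_zero_and_mem (𝔥 := spCartan l) ⟨ξ.1, mem_spCartan.2 ⟨_, hc⟩⟩ hc0 two_ne_zero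
    ?_ ?_ hX hX0
  · rw [spSimple, dif_pos (by simp; omega), LinearMap.sub_apply, spCoord_ofReal, spCoord_ofReal,
      hang]
    simp
  · intro i hi
    have hi' : (i : ℕ) ≠ 0 := fun h => hi (Fin.ext h)
    rw [spSimple]
    split_ifs with h
    · rw [LinearMap.sub_apply, spCoord_ofReal, spCoord_ofReal, hang]
      simp [hi']
    · rw [LinearMap.smul_apply, spCoord_ofReal, hang]
      simp [hi']

end Symplectic

end FlagManifold

theorem lemma4p2 (l : ℕ) (hl : 2 ≤ l) :
    (FlagManifold.bracketSpan (FlagManifold.soSummand l hl 1) (FlagManifold.soSummand l hl 2) ≠ ⊥ ∧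
      ∀ ξ : FlagManifold.soIsotropy l, ξ ∈ LieAlgebra.center ℝ (FlagManifold.soIsotropy l) → ξ ≠ 0 →
        ∀ X : FlagManifold.so l, X ∈ FlagManifold.soSummand l hl 2 → X ≠ 0 →
          ⁅(ξ : FlagManifold.so l), X⁆ ≠ 0 ∧
            ⁅(ξ : FlagManifold.so l), X⁆ ∈ FlagManifold.soSummand l hl 2) ∧
    (FlagManifold.bracketSpan (FlagManifold.spSummand l hl 1) (FlagManifold.spSummand l hl 2) ≠ ⊥ ∧
      ∀ ξ : FlagManifold.spIsotropy l, ξ ∈ LieAlgebra.center ℝ (FlagManifold.spIsotropy l) → ξ ≠ 0 →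
        ∀ X : FlagManifold.sp l, X ∈ FlagManifold.spSummand l hl 2 → X ≠ 0 →
          ⁅(ξ : FlagManifold.sp l), X⁆ ≠ 0 ∧
            ⁅(ξ : FlagManifold.sp l), X⁆ ∈ FlagManifold.spSummand l hl 2) :=
  ⟨⟨FlagManifold.bracketSpan_ne_bot (FlagManifold.soElem_re_last_mem hl)
      (FlagManifold.soElem_re_re_sub_mem hl)
      (FlagManifold.soElem_lie_ne_zero (by simp; omega)),
    fun _ hξ hξ0 _ hX hX0 => FlagManifold.lie_soSummand_two hl hξ hξ0 hX hX0⟩,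
    FlagManifold.bracketSpan_ne_bot (FlagManifold.spElem_zero_one_mem hl)
      (FlagManifold.spElem_zero_zero_mem hl)
      (FlagManifold.spElem_lie_ne_zero (by simp)),
    fun _ hξ hξ0 _ hX hX0 => FlagManifold.lie_spSummand_two hl hξ hξ0 hX hX0⟩
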